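/- **Setting.** For a finite vertex set $V$ and $d\colon V\to\mathbb{N}=\{0,1,2,\dots\}$ with even total $\sum_v d_v$, the configuration model with degree sequence $d$ is the law of the random multigraph (loops and multiple edges allowed) obtained by attaching $d_v$ half-edges to each vertex $v$ and matching all half-edges by a uniformly random perfect matching. A multigraph is identified with its adjacency matrix, a loop at $v$ counting twice in the entry $(v,v)$ and in the degree of $v$, but as one edge. **Lemma 1.3.** For each $n$ let $d^{(n)}_1,\dots,d^{(n)}_n$ be non-negative integers with sum $D^{(n)}$, where $D^{(n)}$ is even and positive for all large $n$, and let $\mathcal G=\mathcal G^{(n)}$ be drawn from the configuration model with this degree sequence. Suppose that for every $C>0$ and every $\varepsilon>0$ there is $N(C,\varepsilon)$ such that $$\sum_{i=1}^n \mathbf 1\{d^{(n)}_i< C\sqrt{D^{(n)}/n}\}\le \varepsilon n\qquad\text{for all } n>N(C,\varepsilon).$$ Then for every $C>0$ and $\varepsilon>0$ there is, for each $n$, a rule assigning to each multigraph $\mathcal G$ on $\{1,\dots,n\}$ a set $R(\mathcal G)$ of vertices such that, writing $\tilde{\mathcal G}$ for the multigraph on the remaining vertices obtained from $\mathcal G$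 by removing the vertices in $R(\mathcal G)$ and all edges with an endpoint in $R(\mathcal G)$: With probability tending to $1$ as $n\to\infty$, $|R(\mathcal G)|\le 2\varepsilon n$, and 1. the number of edges removed is at most $4\varepsilon C\sqrt{nD^{(n)}}$; 2. every vertex of $\tilde{\mathcal G}$ has degree in $\tilde{\mathcal G}$ larger than $C\sqrt{D^{(n)}/n}$. Moreover, 3. for every $n$, conditionally on the set of remaining vertices and on their degrees in $\tilde{\mathcal G}$ (for all values of these that have positive probability), the law of $\tilde{\mathcal G}$ is the configuration model on the remaining vertices with these degrees. -/

import Mathlib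

open MeasureTheory ProbabilityTheory Filter Topology

/-- The half-edges of a degree sequence `d`: the vertex `v` carries `d v` of them. -/
abbrev HalfEdge {V : Type*} (d : V → ℕ) : Type _ := Σ v : V, Fin (d v)

/-- Perfect matchings of the half-edges: involutions without fixed points, sending each half-edge
to the half-edge it is matched with. -/
abbrev PerfectMatching {V : Type*} (d : V → ℕ) : Type _ :=
  {m : Equiv.Perm (HalfEdge d) // ∀ h, m h ≠ h ∧ m (m h) = h}

/-- Every event about the (finitely many) perfect matchings is measurable. -/
instance {V : Type*} (d : V → ℕ) : MeasurableSpace (PerfectMatching d) := ⊤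

/-- Every event about multigraphs, which are given by their adjacency matrices, is measurable
(there are only countably many multigraphs on a finite vertex set). -/
instance {V : Type*} : MeasurableSpace (Matrix V V ℕ) := ⊤

/-- The multigraph obtained from a perfect matching of the half-edges, given by its adjacency
matrix: the entry at `(v, w)` counts the pairs (half-edge of `v`, half-edge of `w`) matched with
each other. A loop at `v` contributes `2` to the entry at `(v, v)`. -/
def PerfectMatching.graph {V : Type*} [DecidableEq V] {d : V → ℕ} (m : PerfectMatching d) :
    Matrix V V ℕ :=
  Matrix.of fun v w => ∑ s : Fin (d v), ∑ t : Fin (d w), if m.1 ⟨v, s⟩ = ⟨w, t⟩ then 1 else 0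

/-- The configuration model with degree sequence `d`: the law of the multigraph obtained from a
uniformly random perfect matching of the half-edges. (It is a probability measure exactly when a
perfect matching exists, that is, when the total degree is even.) -/
noncomputable def configurationModel {V : Type*} [Fintype V] [DecidableEq V] (d : V → ℕ) :
    Measure (Matrix V V ℕ) :=
  (uniformOn (Set.univ : Set (PerfectMatching d))).map PerfectMatching.graph

namespace Multigraph

/-- The degree of a vertex in the multigraph with adjacency matrix `A` (loops count twice). -/
def degree {V : Type*} [Fintype V] (A : Matrix V V ℕ) (v : V) : ℕ := ∑ w, A v w

/-- The number of edges of the multigraph with adjacency matrix `A`: half the sum of the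
degrees. -/
noncomputable def edgeCount {V : Type*} [Fintype V] (A : Matrix V V ℕ) : ℝ :=
  ((∑ v, degree A v : ℕ) : ℝ) / 2

/-- The multigraph on the vertices outside `S` that remains when the vertices in `S` and all edges
with an endpoint in `S` are removed. -/
def removeVertices {V : Type*} (A : Matrix V V ℕ) (S : Finset V) :
    Matrix {v // v ∉ S} {v // v ∉ S} ℕ :=
  A.submatrix Subtype.val Subtype.val

end Multigraph

/-! Put `K = C√(D/n)` and remove the complement `R` of the `K`-core, the largest set inducing all
degrees above `K`. Peeling `R` off vertex by vertex costs at most `K` edges each time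
(`sum_sum_le_core_add`), so at most `K|R|` edges go and the degrees in `R` sum to at most `2K|R|`.
All but `εn` vertices have degree at least `4K`, whence `|R| ≤ 2εn`. For large `n` these bounds hold
surely, not just with high probability.

For the conditional law, rewiring the edges inside the core with its induced degrees kept leaves the
core unchanged (`core_eq_of_agree`). The conditioning event is thus blind to how the half-edges
inside are matched, and a swapping bijection (`card_mul_card_eq`) shows that all their matchings are
equally likely. -/

namespace Multigraph

/-! ### The core: invariance under rewiring, and edge and vertex counts. -/

variable {V : Type*}

/-- Every vertex of `U` has degree larger than `K` in the multigraph induced on `U`. -/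
def MinDegreeAbove (K : ℝ) (A : Matrix V V ℕ) (U : Finset V) : Prop :=
  ∀ v ∈ U, K < ((∑ w ∈ U, A v w : ℕ) : ℝ)

open Classical in
/-- The largest vertex set inducing a multigraph with all degrees larger than `K`. -/
noncomputable def core [Fintype V] (K : ℝ) (A : Matrix V V ℕ) : Finset V :=
  (Finset.univ.filter (MinDegreeAbove K A)).sup id

section Core

variable [Fintype V] {K : ℝ} {A : Matrix V V ℕ}

lemma MinDegreeAbove.subset_core {U : Finset V} (hU : MinDegreeAbove K A U) : U ⊆ core K A := by
  classical
  exact Finset.le_sup (f := id) (by simpa using hU)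

/-- Enlarging the set only increases induced degrees, so the property passes to unions. -/
lemma minDegreeAbove_core : MinDegreeAbove K A (core K A) := by
  classical
  intro v hv
  obtain ⟨U, hU, hvU⟩ := Finset.mem_sup.1 hv
  have hU' : MinDegreeAbove K A U := by simpa using hU
  refine (hU' v hvU).trans_le ?_
  exact_mod_cast Finset.sum_le_sum_of_subset hU'.subset_core

/-- The core is unchanged when the multigraph is modified inside its core without changing the
degrees there. -/
lemma core_eq_of_agree {A' : Matrix V V ℕ}
    (hout : ∀ v w, v ∉ core K A ∨ w ∉ core K A → A' v w = A v w)
    (hdeg : ∀ v ∈ core K A, ∑ w ∈ core K A, A' v w = ∑ w ∈ core K A, A v w) :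
    core K A' = core K A := by
  classical
  -- On sets containing the old core the two multigraphs have equal row sums. The old core therefore
  -- qualifies for `A'`; the new core then contains it, and so qualifies for `A`.
  have hsum : ∀ U : Finset V, core K A ⊆ U → ∀ v, ∑ w ∈ U, A' v w = ∑ w ∈ U, A v w := by
    intro U hTU v
    rw [← Finset.sum_sdiff hTU, ← Finset.sum_sdiff (f := fun w => A v w) hTU]
    congr 1
    · exact Finset.sum_congr rfl fun w hw => hout v w (.inr (Finset.mem_sdiff.1 hw).2)
    · by_cases hv : v ∈ core K A
      · exact hdeg v hv
      · exact Finset.sum_congr rfl fun w _ => hout v w (.inl hv)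
  have hle : core K A ⊆ core K A' := MinDegreeAbove.subset_core fun v hv => by
    rw [hsum _ subset_rfl v]
    exact minDegreeAbove_core v hv
  refine (MinDegreeAbove.subset_core fun v hv => ?_).antisymm hle
  rw [← hsum _ hle v]
  exact minDegreeAbove_core v hv

/-- Peeling off vertices of small degree one by one until the core is reached removes few edges. -/
lemma sum_sum_le_core_add (hA : ∀ v w, A v w = A w v) [DecidableEq V] (U : Finset V)
    (hU : core K A ⊆ U) :
    ((∑ v ∈ U, ∑ w ∈ U, A v w : ℕ) : ℝ) ≤
      ((∑ v ∈ core K A, ∑ w ∈ core K A, A v w : ℕ) : ℝ) + 2 * K * (U \ core K A).card := by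
  induction U using Finset.strongInduction with
  | H U ih =>
    by_cases hgood : MinDegreeAbove K A U
    · rw [hU.antisymm hgood.subset_core]
      simp
    · simp only [MinDegreeAbove, not_forall, not_lt] at hgood
      obtain ⟨v, hvU, hv⟩ := hgood
      have hvT : v ∉ core K A := fun h => by
        refine (minDegreeAbove_core v h).not_ge (le_trans ?_ hv)
        exact_mod_cast Finset.sum_le_sum_of_subset hU
      have hTU : core K A ⊆ U.erase v := fun x hx =>
        Finset.mem_erase.2 ⟨fun h => hvT (h ▸ hx), hU hx⟩
      have key := ih _ (Finset.erase_ssubset hvU) hTU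
      have hcard : ((U \ core K A).card : ℝ) = ((U.erase v) \ core K A).card + 1 := by
        rw [Finset.erase_sdiff_comm]
        exact_mod_cast (Finset.card_erase_add_one (Finset.mem_sdiff.2 ⟨hvU, hvT⟩)).symm
      -- Erasing `v` loses its row and, by symmetry, a column of at most the same sum: hence the
      -- factor 2.
      have hsplit : ∑ x ∈ U, ∑ w ∈ U, A x w ≤
          ∑ x ∈ U.erase v, ∑ w ∈ U.erase v, A x w + 2 * ∑ w ∈ U, A v w := by
        rw [← Finset.add_sum_erase U (fun x => ∑ w ∈ U, A x w) hvU]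
        have h1 : ∑ x ∈ U.erase v, ∑ w ∈ U, A x w =
            ∑ x ∈ U.erase v, A x v + ∑ x ∈ U.erase v, ∑ w ∈ U.erase v, A x w := by
          rw [← Finset.sum_add_distrib]
          exact Finset.sum_congr rfl fun x _ => (Finset.add_sum_erase U (A x) hvU).symm
        have h2 : ∑ x ∈ U.erase v, A x v ≤ ∑ w ∈ U, A v w := by
          rw [Finset.sum_congr rfl fun x _ => hA x v]
          exact Finset.sum_le_sum_of_subset (Finset.erase_subset _ _)
        omega
      have hsplit' : ((∑ x ∈ U, ∑ w ∈ U, A x w : ℕ) : ℝ) ≤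
          ((∑ x ∈ U.erase v, ∑ w ∈ U.erase v, A x w : ℕ) : ℝ) +
            2 * ((∑ w ∈ U, A v w : ℕ) : ℝ) := by exact_mod_cast hsplit
      rw [hcard]
      linarith

lemma degree_removeVertices [DecidableEq V] (A : Matrix V V ℕ) (S : Finset V)
    (v : {v // v ∉ S}) : degree (removeVertices A S) v = ∑ w ∈ Sᶜ, A v w := by
  rw [Finset.sum_subtype Sᶜ (p := (· ∉ S)) (by simp)]
  rfl

lemma edgeCount_removeVertices [DecidableEq V] (A : Matrix V V ℕ) (S : Finset V) :
    edgeCount (removeVertices A S) = ((∑ v ∈ Sᶜ, ∑ w ∈ Sᶜ, A v w : ℕ) : ℝ) / 2 := by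
  simp only [edgeCount, degree_removeVertices]
  rw [Finset.sum_subtype Sᶜ (p := (· ∉ S)) (by simp)]

lemma edgeCount_sub_le [DecidableEq V] (hA : ∀ v w, A v w = A w v) :
    edgeCount A - edgeCount (removeVertices A (core K A)ᶜ) ≤ K * (core K A)ᶜ.card := by
  have h := sum_sum_le_core_add (K := K) hA Finset.univ (Finset.subset_univ _)
  rw [edgeCount_removeVertices, compl_compl, edgeCount]
  rw [← Finset.compl_eq_univ_sdiff] at h
  simp only [degree]
  linarith

/-- The rows indexed by the removed vertices are part of the total that peeling loses. -/
lemma sum_degree_compl_core_le [DecidableEq V] (hA : ∀ v w, A v w = A w v) :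
    ((∑ v ∈ (core K A)ᶜ, degree A v : ℕ) : ℝ) ≤ 2 * K * (core K A)ᶜ.card := by
  have h := sum_sum_le_core_add (K := K) hA Finset.univ (Finset.subset_univ _)
  rw [← Finset.compl_eq_univ_sdiff] at h
  have h1 : ∑ v ∈ (core K A)ᶜ, degree A v + ∑ v ∈ core K A, ∑ w ∈ core K A, A v w ≤
      ∑ v, ∑ w, A v w := by
    rw [← Finset.sum_compl_add_sum (core K A) fun v => ∑ w, A v w]
    exact Nat.add_le_add_left (Finset.sum_le_sum fun v _ =>
      Finset.sum_le_sum_of_subset (Finset.subset_univ _)) _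
  have h2 : ((∑ v ∈ (core K A)ᶜ, degree A v : ℕ) : ℝ) +
      ((∑ v ∈ core K A, ∑ w ∈ core K A, A v w : ℕ) : ℝ) ≤ ((∑ v, ∑ w, A v w : ℕ) : ℝ) := by
    exact_mod_cast h1
  linarith

/-- If all but `m` vertices have degree at least `4 * K`, then all but `2 * m` vertices lie in the
core. -/
lemma card_compl_core_le [DecidableEq V] (hA : ∀ v w, A v w = A w v) (hK : 0 < K) :
    ((core K A)ᶜ.card : ℝ) ≤
      2 * ((Finset.univ.filter fun v => (degree A v : ℝ) < 4 * K).card : ℝ) := by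
  set L := Finset.univ.filter fun v => (degree A v : ℝ) < 4 * K
  set R := (core K A)ᶜ
  have h1 : ((∑ v ∈ R, degree A v : ℕ) : ℝ) ≤ 2 * K * R.card := sum_degree_compl_core_le hA
  have h2 : 4 * K * ((R \ L).card : ℝ) ≤ ((∑ v ∈ R, degree A v : ℕ) : ℝ) := by
    push_cast
    calc 4 * K * ((R \ L).card : ℝ) = ∑ v ∈ R \ L, 4 * K := by
          rw [Finset.sum_const, nsmul_eq_mul, mul_comm]
      _ ≤ ∑ v ∈ R \ L, (degree A v : ℝ) := Finset.sum_le_sum fun v hv => by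
          simpa [L] using (Finset.mem_sdiff.1 hv).2
      _ ≤ ∑ v ∈ R, (degree A v : ℝ) :=
          Finset.sum_le_sum_of_subset_of_nonneg Finset.sdiff_subset fun _ _ _ => by positivity
  have h3 : (R.card : ℝ) ≤ (R \ L).card + L.card := by
    exact_mod_cast Nat.sub_le_iff_le_add.1 (Finset.le_card_sdiff L R)
  -- Hence at least half of the removed vertices are in `L`.
  have h4 : 2 * K * (2 * ((R \ L).card : ℝ)) ≤ 2 * K * R.card := by linarith
  have h5 := le_of_mul_le_mul_left h4 (by positivity)
  linarith

end Core

end Multigraph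

/-! ### Matchings, their multigraphs, and the uniform law. -/

namespace PerfectMatching

lemma nonempty_of_even {V : Type*} [Fintype V] {d : V → ℕ} (h : Even (∑ v, d v)) : Nonempty (PerfectMatching d) := by
  obtain ⟨k, hk⟩ := h
  -- Order reversal on an even number of points is an involution without fixed points.
  let e : HalfEdge d ≃ Fin (k + k) := Fintype.equivFinOfCardEq (by simp [hk])
  refine ⟨⟨(e.trans Fin.revPerm).trans e.symm, fun x => ⟨fun hx => ?_, by simp⟩⟩⟩
  have hx' : (e x).rev = e x := by simpa [Equiv.symm_apply_eq] using hx
  have := congrArg Fin.val hx'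
  rw [Fin.val_rev] at this
  omega

variable {V : Type*} [DecidableEq V] {d : V → ℕ}

lemma graph_apply (m : PerfectMatching d) (v w : V) :
    m.graph v w = ∑ s : Fin (d v), if (m.1 ⟨v, s⟩).1 = w then 1 else 0 := by
  simp only [graph, Matrix.of_apply]
  refine Finset.sum_congr rfl fun s _ => ?_
  obtain ⟨x, t⟩ := m.1 ⟨v, s⟩
  by_cases hx : x = w
  · subst hx
    simp
  · simp [hx]

lemma graph_symm (m : PerfectMatching d) (v w : V) : m.graph v w = m.graph w v := by
  simp only [graph, Matrix.of_apply]
  rw [Finset.sum_comm]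
  refine Finset.sum_congr rfl fun t _ => Finset.sum_congr rfl fun s _ => ?_
  have h : m.1 ⟨v, s⟩ = ⟨w, t⟩ ↔ m.1 ⟨w, t⟩ = ⟨v, s⟩ :=
    ⟨fun h => h ▸ (m.2 _).2, fun h => h ▸ (m.2 _).2⟩
  simp only [h]

lemma degree_graph [Fintype V] (m : PerfectMatching d) (v : V) :
    Multigraph.degree m.graph v = d v := by
  simp only [Multigraph.degree, graph_apply]
  rw [Finset.sum_comm]
  simp

end PerfectMatching

open Classical in
lemma configurationModel_apply {V : Type*} [Fintype V] [DecidableEq V] (d : V → ℕ)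
    (B : Set (Matrix V V ℕ)) :
    configurationModel d B =
      ((Finset.univ.filter fun m : PerfectMatching d => m.graph ∈ B).card : ENNReal) /
        Fintype.card (PerfectMatching d) := by
  rw [configurationModel, Measure.map_apply measurable_from_top MeasurableSpace.measurableSet_top,
    uniformOn_univ, Measure.count_apply MeasurableSpace.measurableSet_top,
    show PerfectMatching.graph ⁻¹' B =
      ((Finset.univ.filter fun m : PerfectMatching d => m.graph ∈ B : Finset _) : Set _) by
        ext; simp,
    Set.encard_coe_eq_coe_finsetCard]
  congr 2

lemma configurationModel_eq_one {V : Type*} [Fintype V] [DecidableEq V] {d : V → ℕ}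
    (hd : Even (∑ v, d v)) {B : Set (Matrix V V ℕ)}
    (hB : ∀ m : PerfectMatching d, m.graph ∈ B) : configurationModel d B = 1 := by
  classical
  have := PerfectMatching.nonempty_of_even hd
  rw [configurationModel_apply, Finset.filter_true_of_mem fun m _ => hB m, Finset.card_univ]
  exact ENNReal.div_self (by simp) (by simp)

/-! ### Rematching a preserved set of half-edges. -/

namespace PerfectMatching

section Splice

variable {V W : Type*} {d : V → ℕ} {d' : W → ℕ} {I : Finset (HalfEdge d)}

open Classical in
/-- The matching that agrees with `m` outside the set `I` of half-edges, which `m` preserves, and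
is a copy of `m'` on `I`. -/
noncomputable def splice (e : HalfEdge d' ≃ {h // h ∈ I}) (m : PerfectMatching d)
    (hm : ∀ h, m.1 h ∈ I ↔ h ∈ I) (m' : PerfectMatching d') : PerfectMatching d :=
  ⟨Equiv.Perm.subtypeCongr (e.permCongr m'.1)
      (m.1.subtypePerm (p := (· ∉ I)) fun h => not_congr (hm h)), fun h => by
    by_cases hh : h ∈ I
    · rw [Equiv.Perm.subtypeCongr.left_apply _ _ hh]
      rw [Equiv.Perm.subtypeCongr.left_apply _ _ (Subtype.property _)]
      constructor
      · intro h1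
        have h2 : e.permCongr m'.1 ⟨h, hh⟩ = ⟨h, hh⟩ := Subtype.ext h1
        rw [Equiv.permCongr_apply, ← Equiv.eq_symm_apply] at h2
        exact (m'.2 _).1 h2
      · simp [Equiv.permCongr_apply, (m'.2 _).2]
    · rw [Equiv.Perm.subtypeCongr.right_apply _ _ hh]
      refine ⟨(m.2 h).1, ?_⟩
      change Equiv.Perm.subtypeCongr _ _ (m.1 h) = h
      rw [Equiv.Perm.subtypeCongr.right_apply _ _ (mt (hm h).1 hh)]
      exact (m.2 h).2⟩

lemma splice_apply (e : HalfEdge d' ≃ {h // h ∈ I}) (m : PerfectMatching d)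
    (hm : ∀ h, m.1 h ∈ I ↔ h ∈ I) (m' : PerfectMatching d') (x : HalfEdge d') :
    (splice e m hm m').1 (e x).1 = (e (m'.1 x)).1 := by
  classical
  simp only [splice]
  rw [Equiv.Perm.subtypeCongr.left_apply _ _ (e x).2]
  simp [Equiv.permCongr_apply]

lemma splice_apply_of_notMem (e : HalfEdge d' ≃ {h // h ∈ I}) (m : PerfectMatching d)
    (hm : ∀ h, m.1 h ∈ I ↔ h ∈ I) (m' : PerfectMatching d') {h : HalfEdge d} (hh : h ∉ I) :
    (splice e m hm m').1 h = m.1 h := by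
  classical
  simp only [splice]
  rw [Equiv.Perm.subtypeCongr.right_apply _ _ hh]
  rfl

/-- The matching induced by `m` on a set `I` of half-edges that it preserves. -/
def restrict (e : HalfEdge d' ≃ {h // h ∈ I}) (m : PerfectMatching d)
    (hm : ∀ h, m.1 h ∈ I ↔ h ∈ I) : PerfectMatching d' :=
  ⟨e.symm.permCongr (m.1.subtypePerm hm), fun x => by
    constructor
    · intro h
      rw [Equiv.permCongr_apply, Equiv.symm_apply_eq] at h
      exact (m.2 (e x).1).1 (congrArg Subtype.val h)
    · simp only [Equiv.permCongr_apply, Equiv.symm_symm, Equiv.apply_symm_apply,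
        Equiv.symm_apply_eq]
      exact Subtype.ext (m.2 (e x).1).2⟩

lemma restrict_apply (e : HalfEdge d' ≃ {h // h ∈ I}) (m : PerfectMatching d)
    (hm : ∀ h, m.1 h ∈ I ↔ h ∈ I) (x : HalfEdge d') :
    (e ((restrict e m hm).1 x)).1 = m.1 (e x).1 := by
  simp [restrict, Equiv.permCongr_apply]

lemma ext_of_equiv (e : HalfEdge d' ≃ {h // h ∈ I}) {m₁ m₂ : PerfectMatching d}
    (hI : ∀ x, m₁.1 (e x).1 = m₂.1 (e x).1) (hI' : ∀ h, h ∉ I → m₁.1 h = m₂.1 h) : m₁ = m₂ := by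
  refine Subtype.ext (Equiv.ext fun h => ?_)
  by_cases hh : h ∈ I
  · simpa using hI (e.symm ⟨h, hh⟩)
  · exact hI' h hh

/-- With `restrict_splice`, this makes `(m, m') ↦ (splice, restrict)` undo itself: the two matchings
swap their parts on `I`. -/
lemma splice_splice_restrict (e : HalfEdge d' ≃ {h // h ∈ I}) (m : PerfectMatching d)
    (hm : ∀ h, m.1 h ∈ I ↔ h ∈ I) (m' : PerfectMatching d')
    (hs : ∀ h, (splice e m hm m').1 h ∈ I ↔ h ∈ I) :
    splice e (splice e m hm m') hs (restrict e m hm) = m := by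
  refine ext_of_equiv e (fun x => ?_) fun h hh => ?_
  · rw [splice_apply, restrict_apply]
  · rw [splice_apply_of_notMem _ _ _ _ hh, splice_apply_of_notMem _ _ _ _ hh]

lemma restrict_splice (e : HalfEdge d' ≃ {h // h ∈ I}) (m : PerfectMatching d)
    (hm : ∀ h, m.1 h ∈ I ↔ h ∈ I) (m' : PerfectMatching d')
    (hs : ∀ h, (splice e m hm m').1 h ∈ I ↔ h ∈ I) :
    restrict e (splice e m hm m') hs = m' := by
  refine Subtype.ext (Equiv.ext fun x => e.injective (Subtype.ext ?_))
  rw [restrict_apply, splice_apply]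

end Splice

/-! ### Half-edges of the multigraph outside `S`, and the double count. -/

variable {V : Type*} [Fintype V] [DecidableEq V] {d : V → ℕ} {S : Finset V}

/-- The half-edges that are matched, and whose partners are attached, outside `S`. -/
def innerHalfEdges (m : PerfectMatching d) (S : Finset V) : Finset (HalfEdge d) :=
  Finset.univ.filter fun h => h.1 ∉ S ∧ (m.1 h).1 ∉ S

lemma mem_innerHalfEdges {m : PerfectMatching d} {h : HalfEdge d} :
    h ∈ m.innerHalfEdges S ↔ h.1 ∉ S ∧ (m.1 h).1 ∉ S := by
  simp [innerHalfEdges]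

lemma apply_mem_innerHalfEdges {m : PerfectMatching d} {h : HalfEdge d} :
    m.1 h ∈ m.innerHalfEdges S ↔ h ∈ m.innerHalfEdges S := by
  rw [mem_innerHalfEdges, mem_innerHalfEdges, (m.2 h).2, and_comm]

lemma degree_removeVertices_graph (m : PerfectMatching d) (v : {v // v ∉ S}) :
    Multigraph.degree (Multigraph.removeVertices m.graph S) v =
      (Finset.univ.filter fun s : Fin (d v) =>
        (⟨v, s⟩ : HalfEdge d) ∈ m.innerHalfEdges S).card := by
  rw [Multigraph.degree_removeVertices]
  simp only [graph_apply]
  rw [Finset.sum_comm, Finset.card_filter]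
  refine Finset.sum_congr rfl fun s _ => ?_
  simp [mem_innerHalfEdges, v.2]

lemma exists_equiv_innerHalfEdges (m : PerfectMatching d) {d' : {v // v ∉ S} → ℕ}
    (hd : Multigraph.degree (Multigraph.removeVertices m.graph S) = d') :
    ∃ e : HalfEdge d' ≃ {h // h ∈ m.innerHalfEdges S}, ∀ x, (e x).1.1 = x.1.1 := by
  have hcard : ∀ v : {v // v ∉ S}, Fintype.card {s : Fin (d v) //
      (⟨v, s⟩ : HalfEdge d) ∈ m.innerHalfEdges S} = d' v := fun v => by
    rw [Fintype.card_subtype, ← hd, degree_removeVertices_graph]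
  let e₁ : HalfEdge d' ≃ Σ v : {v // v ∉ S}, {s : Fin (d v) //
      (⟨v, s⟩ : HalfEdge d) ∈ m.innerHalfEdges S} :=
    Equiv.sigmaCongrRight fun v => (Fintype.equivFinOfCardEq (hcard v)).symm
  let e₂ : (Σ v : {v // v ∉ S}, {s : Fin (d v) //
      (⟨v, s⟩ : HalfEdge d) ∈ m.innerHalfEdges S}) ≃ {h // h ∈ m.innerHalfEdges S} :=
    { toFun := fun x => ⟨⟨x.1, x.2.1⟩, x.2.2⟩
      invFun := fun h => ⟨⟨h.1.1, (mem_innerHalfEdges.1 h.2).1⟩, ⟨h.1.2, h.2⟩⟩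
      left_inv := fun _ => rfl
      right_inv := fun _ => rfl }
  exact ⟨e₁.trans e₂, fun _ => rfl⟩

section Inner

variable {d' : {v // v ∉ S} → ℕ} {I : Finset (HalfEdge d)} {e : HalfEdge d' ≃ {h // h ∈ I}}

lemma innerHalfEdges_splice {m : PerfectMatching d} (hI : m.innerHalfEdges S = I)
    (hm : ∀ h, m.1 h ∈ I ↔ h ∈ I) (m' : PerfectMatching d') :
    (splice e m hm m').innerHalfEdges S = I := by
  ext h
  rw [mem_innerHalfEdges]
  by_cases hh : h ∈ I
  · obtain ⟨x, hx⟩ := e.surjective ⟨h, hh⟩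
    have hx' : (e x).1 = h := congrArg Subtype.val hx
    have hin : ∀ h ∈ I, h.1 ∉ S := fun h hh => (mem_innerHalfEdges.1 (hI ▸ hh)).1
    rw [← hx', splice_apply]
    exact ⟨fun _ => (e x).2, fun _ => ⟨hin _ (e x).2, hin _ (e _).2⟩⟩
  · rw [splice_apply_of_notMem _ _ _ _ hh, ← hI, mem_innerHalfEdges]

lemma graph_apply_of_innerHalfEdges {m m' : PerfectMatching d}
    (hI : m.innerHalfEdges S = I) (hI' : m'.innerHalfEdges S = I)
    (hout : ∀ h, h ∉ I → m'.1 h = m.1 h) {v w : V} (hvw : v ∈ S ∨ w ∈ S) :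
    m'.graph v w = m.graph v w := by
  rw [graph_apply, graph_apply]
  refine Finset.sum_congr rfl fun s _ => ?_
  by_cases hh : (⟨v, s⟩ : HalfEdge d) ∈ I
  · have h1 := mem_innerHalfEdges.1 (hI ▸ hh)
    have h2 := mem_innerHalfEdges.1 (hI' ▸ hh)
    have hw : w ∈ S := hvw.resolve_left h1.1
    rw [if_neg fun h : (m'.1 _).1 = w => h2.2 (h.symm ▸ hw), if_neg fun h : (m.1 _).1 = w => h1.2 (h.symm ▸ hw)]
  · rw [hout _ hh]

lemma graph_restrict (he : ∀ x, (e x).1.1 = x.1.1) {m : PerfectMatching d}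
    (hI : m.innerHalfEdges S = I) (hm : ∀ h, m.1 h ∈ I ↔ h ∈ I) :
    (restrict e m hm).graph = Multigraph.removeVertices m.graph S := by
  classical
  ext v w
  -- Counting entries by half-edges lets `e` itself serve as the bijection.
  have hcard : ∀ {W : Type _} [Fintype W] [DecidableEq W] {c : W → ℕ} (m : PerfectMatching c)
      (v w : W), m.graph v w =
        (Finset.univ.filter fun x : HalfEdge c => x.1 = v ∧ (m.1 x).1 = w).card := by
    intro W _ _ c m v w
    rw [graph_apply, Finset.card_filter, Fintype.sum_sigma, Finset.sum_eq_single v]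
    · simp
    · intro u _ hu
      simp [hu]
    · simp
  simp only [Multigraph.removeVertices, Matrix.submatrix_apply]
  rw [hcard, hcard]
  refine Finset.card_bij (fun x _ => (e x).1) ?_ ?_ ?_
  · intro x hx
    simp only [Finset.mem_filter, Finset.mem_univ, true_and] at hx ⊢
    rw [← restrict_apply e m hm, he, he, hx.1, hx.2]
    exact ⟨rfl, rfl⟩
  · intro x _ y _ h
    exact e.injective (Subtype.ext h)
  · intro h hh
    simp only [Finset.mem_filter, Finset.mem_univ, true_and] at hh
    have hhI : h ∈ I := by
      rw [← hI, mem_innerHalfEdges, hh.1, hh.2]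
      exact ⟨v.2, w.2⟩
    obtain ⟨x, hx⟩ := e.surjective ⟨h, hhI⟩
    have hx' : (e x).1 = h := congrArg Subtype.val hx
    refine ⟨x, ?_, hx'⟩
    simp only [Finset.mem_filter, Finset.mem_univ, true_and]
    constructor
    · exact Subtype.ext (by rw [← he, hx', hh.1])
    · exact Subtype.ext (by rw [← he, restrict_apply, hx', hh.2])

end Inner

open Classical in
/-- Double counting behind the conditional law: when an event `E` only depends on the edges with an
endpoint in `S` and on the degrees in the multigraph outside `S`, all matchings of the remaining
half-edges occur equally often on it. -/
lemma card_mul_card_eq {d' : {v // v ∉ S} → ℕ} {E : Set (Matrix V V ℕ)}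
    (hEdeg : ∀ A ∈ E, Multigraph.degree (Multigraph.removeVertices A S) = d')
    (hE : ∀ A ∈ E, ∀ A', (∀ v w, v ∈ S ∨ w ∈ S → A' v w = A v w) →
      Multigraph.degree (Multigraph.removeVertices A' S) = d' → A' ∈ E)
    (B : Set (Matrix {v // v ∉ S} {v // v ∉ S} ℕ)) :
    (Finset.univ.filter fun m : PerfectMatching d =>
        m.graph ∈ E ∧ Multigraph.removeVertices m.graph S ∈ B).card *
      Fintype.card (PerfectMatching d') =
    (Finset.univ.filter fun m : PerfectMatching d => m.graph ∈ E).card *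
      (Finset.univ.filter fun m : PerfectMatching d' => m.graph ∈ B).card := by
  rw [Finset.card_eq_sum_card_fiberwise (f := fun m : PerfectMatching d => m.innerHalfEdges S)
      (t := Finset.univ) (fun _ _ => by simp),
    Finset.card_eq_sum_card_fiberwise (s := Finset.univ.filter _)
      (f := fun m : PerfectMatching d => m.innerHalfEdges S)
      (t := Finset.univ) (fun _ _ => by simp),
    Finset.sum_mul, Finset.sum_mul]
  -- The identity is proved separately for each set `I` of inner half-edges.
  refine Finset.sum_congr rfl fun I _ => ?_
  rw [Finset.filter_filter, Finset.filter_filter]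
  by_cases hne : ∃ m : PerfectMatching d, m.graph ∈ E ∧ m.innerHalfEdges S = I
  swap
  · rw [Finset.filter_false_of_mem fun m _ h => hne ⟨m, h.1.1, h.2⟩,
      Finset.filter_false_of_mem fun m _ h => hne ⟨m, h⟩]
    simp
  obtain ⟨m₀, hm₀, hI₀⟩ := hne
  -- One labelling `e`, chosen from a single `m₀`, serves the whole fibre; otherwise the swap would
  -- not be invertible.
  obtain ⟨e, he⟩ := exists_equiv_innerHalfEdges m₀ (hEdeg _ hm₀)
  subst hI₀
  have hpres : ∀ {m : PerfectMatching d}, m.innerHalfEdges S = m₀.innerHalfEdges S →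
      ∀ h, m.1 h ∈ m₀.innerHalfEdges S ↔ h ∈ m₀.innerHalfEdges S := fun hI h => by
    rw [← hI, apply_mem_innerHalfEdges]
  have hsplice : ∀ (m : PerfectMatching d) (hI : m.innerHalfEdges S = m₀.innerHalfEdges S)
      (m' : PerfectMatching d'), m.graph ∈ E → (splice e m (hpres hI) m').graph ∈ E := by
    intro m hI m' hm
    have hI' := innerHalfEdges_splice (e := e) hI (hpres hI) m'
    refine hE _ hm _ (fun v w => graph_apply_of_innerHalfEdges hI hI'
      fun h hh => splice_apply_of_notMem _ _ _ _ hh) ?_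
    refine Eq.trans (funext fun v => ?_) (hEdeg _ hm)
    rw [degree_removeVertices_graph, degree_removeVertices_graph, hI, hI']
  rw [← Finset.card_univ, ← Finset.card_product, ← Finset.card_product]
  have hfst : ∀ a ∈ (Finset.univ.filter fun m : PerfectMatching d =>
      (m.graph ∈ E ∧ Multigraph.removeVertices m.graph S ∈ B) ∧
        m.innerHalfEdges S = m₀.innerHalfEdges S) ×ˢ
      (Finset.univ : Finset (PerfectMatching d')),
      a.1.innerHalfEdges S = m₀.innerHalfEdges S := fun a ha =>
    (Finset.mem_filter.1 (Finset.mem_product.1 ha).1).2.2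
  have hfst' : ∀ a ∈ (Finset.univ.filter fun m : PerfectMatching d =>
      m.graph ∈ E ∧ m.innerHalfEdges S = m₀.innerHalfEdges S) ×ˢ
      (Finset.univ.filter fun m : PerfectMatching d' => m.graph ∈ B),
      a.1.innerHalfEdges S = m₀.innerHalfEdges S := fun a ha =>
    (Finset.mem_filter.1 (Finset.mem_product.1 ha).1).2.2
  -- The swap moves the condition `B` from the inner part of the first matching to the second
  -- matching.
  refine Finset.card_bij'
    (fun a ha => (splice e a.1 (hpres (hfst a ha)) a.2, restrict e a.1 (hpres (hfst a ha))))
    (fun a ha => (splice e a.1 (hpres (hfst' a ha)) a.2, restrict e a.1 (hpres (hfst' a ha))))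
    ?_ ?_ ?_ ?_
  · intro a ha
    have hI := hfst a ha
    simp only [Finset.mem_product, Finset.mem_filter, Finset.mem_univ, true_and, and_true] at ha ⊢
    refine ⟨⟨hsplice _ hI _ ha.1.1, innerHalfEdges_splice hI _ _⟩, ?_⟩
    rw [graph_restrict he hI]
    exact ha.1.2
  · intro a ha
    have hI := hfst' a ha
    simp only [Finset.mem_product, Finset.mem_filter, Finset.mem_univ, true_and, and_true] at ha ⊢
    refine ⟨⟨hsplice _ hI _ ha.1.1, ?_⟩, innerHalfEdges_splice hI _ _⟩
    have hI' := innerHalfEdges_splice (e := e) hI (hpres hI) a.2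
    rw [← graph_restrict he hI' (hpres hI'), restrict_splice]
    exact ha.2
  · intro a ha
    have hs := hpres (innerHalfEdges_splice (e := e) (hfst a ha) (hpres (hfst a ha)) a.2)
    exact Prod.ext (splice_splice_restrict e a.1 (hpres (hfst a ha)) a.2 hs)
      (restrict_splice e a.1 (hpres (hfst a ha)) a.2 hs)
  · intro a ha
    have hs := hpres (innerHalfEdges_splice (e := e) (hfst' a ha) (hpres (hfst' a ha)) a.2)
    exact Prod.ext (splice_splice_restrict e a.1 (hpres (hfst' a ha)) a.2 hs)
      (restrict_splice e a.1 (hpres (hfst' a ha)) a.2 hs)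

end PerfectMatching

/-- Conditionally on an event that only depends on the edges with an endpoint in `S` and on the
degrees outside `S`, and that fixes these degrees to be `d'`, the rest of the configuration model
is a configuration model. -/
lemma map_removeVertices_cond_configurationModel {V : Type*} [Fintype V] [DecidableEq V]
    {d : V → ℕ} {S : Finset V} {d' : {v // v ∉ S} → ℕ} {E : Set (Matrix V V ℕ)}
    (hEdeg : ∀ A ∈ E, Multigraph.degree (Multigraph.removeVertices A S) = d')
    (hE : ∀ A ∈ E, ∀ A', (∀ v w, v ∈ S ∨ w ∈ S → A' v w = A v w) →
      Multigraph.degree (Multigraph.removeVertices A' S) = d' → A' ∈ E)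
    (h0 : configurationModel d E ≠ 0) :
    (ProbabilityTheory.cond (configurationModel d) E).map
      (fun A => Multigraph.removeVertices A S) = configurationModel d' := by
  classical
  ext B -
  have key := PerfectMatching.card_mul_card_eq (d := d) hEdeg hE B
  rw [Measure.map_apply measurable_from_top MeasurableSpace.measurableSet_top,
    cond_apply MeasurableSpace.measurableSet_top]
  rw [configurationModel_apply] at h0
  simp only [configurationModel_apply, Set.mem_inter_iff, Set.mem_preimage]
  set a := (Finset.univ.filter fun m : PerfectMatching d => m.graph ∈ E).card with ha
  have ha0 : a ≠ 0 := fun h => h0 (by simp [h])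
  obtain ⟨m, hm⟩ := Finset.card_ne_zero.1 ha0
  obtain ⟨e, -⟩ := PerfectMatching.exists_equiv_innerHalfEdges m
    (hEdeg _ (Finset.mem_filter.1 hm).2)
  have hN : Fintype.card (PerfectMatching d) ≠ 0 := @Fintype.card_ne_zero _ _ ⟨m⟩
  -- A matching in `E` restricts to one with degrees `d'`, so the division is legitimate.
  have hP : Fintype.card (PerfectMatching d') ≠ 0 := @Fintype.card_ne_zero _ _
    ⟨PerfectMatching.restrict e m fun _ => PerfectMatching.apply_mem_innerHalfEdges⟩
  have key' := congrArg (Nat.cast : ℕ → ENNReal) key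
  push_cast at key'
  rw [ENNReal.inv_div (.inl (ENNReal.natCast_ne_top _)) (.inl (Nat.cast_ne_zero.2 hN)), mul_comm,
    ← mul_div_assoc, ENNReal.div_mul_cancel (Nat.cast_ne_zero.2 hN) (ENNReal.natCast_ne_top _),
    ENNReal.div_eq_div_iff (Nat.cast_ne_zero.2 hP) (ENNReal.natCast_ne_top _)
      (Nat.cast_ne_zero.2 ha0) (ENNReal.natCast_ne_top _), ← key', mul_comm]

theorem lemma1p3
    (d : (n : ℕ) → Fin n → ℕ) (D : ℕ → ℕ) (hD : ∀ n, D n = ∑ i, d n i)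
    (heven : ∀ᶠ n in atTop, Even (D n))
    (hpos : ∀ᶠ n in atTop, 0 < D n)
    (hlight : ∀ C : ℝ, 0 < C → ∀ ε : ℝ, 0 < ε → ∀ᶠ n : ℕ in atTop,
      (Finset.card {i : Fin n | (d n i : ℝ) < C * √((D n : ℝ) / n)} : ℝ) ≤ ε * n)
    (C : ℝ) (hC : 0 < C) (ε : ℝ) (hε : 0 < ε) :
    -- `R n A` is the set of vertices that are removed from the graph `A`
    ∃ R : (n : ℕ) → Matrix (Fin n) (Fin n) ℕ → Finset (Fin n),
      Tendsto
        (fun n : ℕ => configurationModel (d n)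
          {A | ((R n A).card : ℝ) ≤ 2 * ε * n ∧
            Multigraph.edgeCount A - Multigraph.edgeCount (Multigraph.removeVertices A (R n A))
              ≤ 4 * ε * C * √((n : ℝ) * D n) ∧
            ∀ v, C * √((D n : ℝ) / n) <
              (Multigraph.degree (Multigraph.removeVertices A (R n A)) v : ℝ)})
        atTop (𝓝 1) ∧
      -- given the remaining vertices and their degrees, the rest is a configuration model
      ∀ (n : ℕ) (S : Finset (Fin n)) (d' : {v // v ∉ S} → ℕ),
        configurationModel (d n)
          {A | R n A = S ∧ Multigraph.degree (Multigraph.removeVertices A S) = d'} ≠ 0 →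
        (ProbabilityTheory.cond (configurationModel (d n))
            {A | R n A = S ∧ Multigraph.degree (Multigraph.removeVertices A S) = d'}).map
          (fun A => Multigraph.removeVertices A S) = configurationModel d' := by
  refine ⟨fun n A => (Multigraph.core (C * √((D n : ℝ) / n)) A)ᶜ, ?_, ?_⟩
  · refine tendsto_const_nhds.congr' ?_
    -- The constant `4 * C` matches the threshold `4 * K` of `card_compl_core_le`.
    filter_upwards [heven, hpos, hlight (4 * C) (by positivity) ε hε, eventually_gt_atTop 0]
      with n hn hDn hl hn0
    symm
    refine configurationModel_eq_one (hD n ▸ hn) fun m => ?_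
    have hA := m.graph_symm
    set K := C * √((D n : ℝ) / n) with hK
    have hK0 : 0 < K := by positivity
    have hcard : ((Multigraph.core K m.graph)ᶜ.card : ℝ) ≤ 2 * ε * n := by
      refine (Multigraph.card_compl_core_le hA hK0).trans ?_
      simp only [PerfectMatching.degree_graph, hK, ← mul_assoc]
      linarith
    refine ⟨hcard, (Multigraph.edgeCount_sub_le hA).trans ?_, fun v => ?_⟩
    · have hsqrt : √((D n : ℝ) / n) * n = √((n : ℝ) * D n) := by
        have hn' : (0 : ℝ) < n := by exact_mod_cast hn0
        rw [← Real.sqrt_sq hn'.le, ← Real.sqrt_mul (by positivity), Real.sqrt_sq hn'.le]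
        congr 1
        field_simp
      calc K * ((Multigraph.core K m.graph)ᶜ.card : ℝ) ≤ K * (2 * ε * n) := by gcongr
        _ = 2 * ε * C * √((n : ℝ) * D n) := by rw [← hsqrt, hK]; ring
        -- The argument gives the constant 2; the stated 4 is slack.
        _ ≤ 4 * ε * C * √((n : ℝ) * D n) := by gcongr; norm_num
    · rw [Multigraph.degree_removeVertices, compl_compl]
      exact Multigraph.minDegreeAbove_core _ (by simpa using v.2)
  · intro n S d' h0
    refine map_removeVertices_cond_configurationModel (fun A hA => hA.2) ?_ h0
    rintro A ⟨rfl, hd⟩ A' hout hd'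
    refine ⟨congrArg (·ᶜ) (Multigraph.core_eq_of_agree ?_ ?_), hd'⟩
    · exact fun v w h => hout v w (by simpa using h)
    · intro v hv
      have := congrFun (hd'.trans hd.symm) ⟨v, by simpa using hv⟩
      simpa only [Multigraph.degree_removeVertices, compl_compl] using this
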